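/- Let $X$ be a compact metrizable space, $T:X\to X$ a homeomorphism, and $d\ge 0$ an integer. For a topological space $Y$ and a finite open cover $\alpha$ of $Y$, let $\mathrm{ord}(\alpha)=\sup_{y\in Y}\bigl(\#\{U\in\alpha: y\in U\}-1\bigr)$ and let $D(\alpha)$ be the minimum of $\mathrm{ord}(\beta)$ over all finite open covers $\beta$ of $Y$ refining $\alpha$ (every member of $\beta$ is contained in a member of $\alpha$). The topological dimension of $Y$ is $\dim(Y)=\sup_\alpha D(\alpha)\in\mathbb N\cup\{\infty\}$, over all finite open covers $\alpha$ of $Y$, with $\dim(\emptyset)=0$. For $k\ge 1$ let $P_k\subset X$ be the set of periodic points of $T$ of period at most $k$, with the subspace topology, let $P=\bigcup_{k\ge1}P_k$ be the set of all periodic points, and put $$\mathrm{perdim}(X,T)=\sup_{k\ge 1}\frac{\dim(P_k)}{k}\in[0,\infty].$$ For a continuous map $f:X\to[0,1]^d$ let $I_f:X\to([0,1]^d)^{\mathbb Z}$, $I_f(x)=(f(T^i x))_{i\in\mathbb Z}$. If $\mathrm{perdim}(X,T)<\frac d2$, then the set $$\{f\in C(X,[0,1]^d)\;:\;I_f(x)\ne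 I_f(y)\text{ for all }x,y\in P\text{ with }x\neq y\}$$ is dense in $C(X,[0,1]^d)$ for the topology of uniform convergence. -/

import Mathlib

open scoped ENNReal unitInterval

namespace TopDim

variable {X : Type*}

/-- The family `α` of subsets of `X` is a finite open cover of `X`. -/
def IsFiniteOpenCover [TopologicalSpace X] (α : Set (Set X)) : Prop :=
  α.Finite ∧ (∀ U ∈ α, IsOpen U) ∧ ⋃₀ α = Set.univ

/-- `ord_x(α) = ∑_{U ∈ α} 1_U(x) - 1`. When `α` is a cover of `X` the count is at least `1`, so
the subtraction does not truncate. -/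
noncomputable def orderAt (α : Set (Set X)) (x : X) : ℕ∞ :=
  {U ∈ α | x ∈ U}.encard - 1

/-- The order of a cover: `ord(α) = sup_x ord_x(α)`. -/
noncomputable def order (α : Set (Set X)) : ℕ∞ :=
  ⨆ x : X, orderAt α x

/-- `β` refines `α`: every member of `β` is contained in a member of `α`. -/
def Refines (β α : Set (Set X)) : Prop :=
  ∀ V ∈ β, ∃ U ∈ α, V ⊆ U

/-- `D(α)`: the least order of a finite open cover that refines `α`. -/
noncomputable def minOrder [TopologicalSpace X] (α : Set (Set X)) : ℕ∞ :=
  ⨅ (β : Set (Set X)) (_ : IsFiniteOpenCover β ∧ Refines β α), order β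

/-- The topological (Lebesgue covering) dimension `dim(X) = sup_α D(α)`, over the finite open
covers `α` of `X`. The empty space gets dimension `0`. -/
noncomputable def dim (X : Type*) [TopologicalSpace X] : ℕ∞ :=
  ⨆ (α : Set (Set X)) (_ : IsFiniteOpenCover α), minOrder α

end TopDim

namespace DynSys

variable {X : Type*} [TopologicalSpace X]

/-- `P_k`: the points that are periodic with period at most `k`. -/
def periodicLE (T : X ≃ₜ X) (k : ℕ) : Set X :=
  {x | ∃ n : ℕ, 1 ≤ n ∧ n ≤ k ∧ Function.IsPeriodicPt T n x}

/-- The periodic dimension `perdim(X,T) = sup_{k ≥ 1} dim(P_k) / k`, in `[0,∞]`. -/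
noncomputable def perdim (T : X ≃ₜ X) : ℝ≥0∞ :=
  ⨆ (k : ℕ) (_ : 1 ≤ k), ((TopDim.dim (periodicLE T k) : ℕ∞) : ℝ≥0∞) / (k : ℝ≥0∞)

/-- The orbit map `I_f : x ↦ (f (T^i x))_{i ∈ ℤ}`, with values in `([0,1]^d)^ℤ`. -/
def orbitMap (T : X ≃ₜ X) {d : ℕ} (f : C(X, Fin d → I)) (x : X) : ℤ → Fin d → I :=
  fun i => f ((T ^ i) x)

/-- `D_K`: the continuous maps `f : X → [0,1]^d` whose orbit map separates the two points of every
pair in `K`. -/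
def separatingMaps (T : X ≃ₜ X) (d : ℕ) (K : Set (X × X)) : Set C(X, Fin d → I) :=
  {f | ∀ p ∈ K, ∃ i : ℤ, orbitMap T f p.1 i ≠ orbitMap T f p.2 i}

end DynSys

/-! The proof is a Baire category argument. Pairs of distinct periodic points fall into countably
many classes: minimal periods `n ≥ m` on different orbits, or period `n` with `y = T^[j] x`, `0 < j
< n`. Each class is covered by countably many compact sets `K`; the maps separating `K` form an open
set, so only its density is at issue.

Near a pair, the iterates involved have disjoint closed neighbourhoods, so `f` can be perturbed
independently along them. The vector `(f (T^[i] z))_{i<n}` is a map from `P_n`, of dimension `a`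
with `2a < nd`, to `ℝ^{nd}`; it is approximated by a map into finitely many `a`-dimensional flats,
then translated. For different orbits it must avoid flats of dimension `b`, with `2b < md ≤ nd`. On
one orbit it must avoid the vectors invariant under the cyclic shift by `j`, a subspace of dimension
at most `nd/2`. A small generic translation does either. -/

open Topology Module

/-! ### General position of finite unions of flats. -/

section Flats

variable {E F : Type*} [NormedAddCommGroup E] [NormedSpace ℝ E] [NormedAddCommGroup F]
  [NormedSpace ℝ F]

/-- The set `S` is contained in a finite union of affine subspaces of dimension at most `a`. -/
def CoveredByFlats (a : ℕ) (S : Set E) : Prop :=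
  ∃ s : Set (E × Submodule ℝ E), s.Finite ∧ (∀ q ∈ s, finrank ℝ q.2 ≤ a) ∧
    ∀ x ∈ S, ∃ q ∈ s, x - q.1 ∈ q.2

theorem coveredByFlats_submodule (W : Submodule ℝ E) :
    CoveredByFlats (finrank ℝ W) (W : Set E) :=
  ⟨{(0, W)}, Set.finite_singleton _, by simp, fun x hx => ⟨(0, W), rfl, by simpa using hx⟩⟩

theorem CoveredByFlats.image [FiniteDimensional ℝ E] {a : ℕ} {S : Set E}
    (hS : CoveredByFlats a S) (L : E →ₗ[ℝ] F) : CoveredByFlats a (L '' S) := by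
  obtain ⟨s, hs, hdim, hcov⟩ := hS
  refine ⟨(fun q => (L q.1, q.2.map L)) '' s, hs.image _, ?_, ?_⟩
  · rintro _ ⟨q, hq, rfl⟩
    exact (Submodule.finrank_map_le L q.2).trans (hdim q hq)
  · rintro _ ⟨x, hx, rfl⟩
    obtain ⟨q, hq, hxq⟩ := hcov x hx
    refine ⟨_, ⟨q, hq, rfl⟩, ?_⟩
    exact ⟨x - q.1, hxq, map_sub L _ _⟩

/-- If `a + b < dim E`, finite unions of affine subspaces of dimensions `a` and `b` can be made disjoint
by an arbitrarily small translation. -/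
theorem CoveredByFlats.exists_translation [FiniteDimensional ℝ E] {a b : ℕ} {S S' : Set E}
    (hS : CoveredByFlats a S) (hS' : CoveredByFlats b S') (hab : a + b < finrank ℝ E)
    {ε : ℝ} (hε : 0 < ε) : ∃ c : E, ‖c‖ < ε ∧ ∀ x ∈ S, ∀ y ∈ S', x + c ≠ y := by
  borelize E
  obtain ⟨s, hs, hdim, hcov⟩ := hS
  obtain ⟨s', hs', hdim', hcov'⟩ := hS'
  -- The translations making two given flats meet lie in `A p`, of dimension at most `a + b`, hence
  -- Lebesgue null.
  let A : (E × Submodule ℝ E) × (E × Submodule ℝ E) → AffineSubspace ℝ E :=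
    fun p => AffineSubspace.mk' (p.2.1 - p.1.1) (p.1.2 ⊔ p.2.2)
  let μ : MeasureTheory.Measure E := MeasureTheory.Measure.addHaar
  have hnull : μ (⋃ p ∈ s ×ˢ s', (A p : Set E)) = 0 := by
    refine (MeasureTheory.measure_biUnion_null_iff (hs.prod hs').countable).2 fun p hp => ?_
    refine MeasureTheory.Measure.addHaar_affineSubspace μ _ fun htop => ?_
    have hdir : p.1.2 ⊔ p.2.2 = ⊤ := by
      rw [← AffineSubspace.direction_mk' (p.2.1 - p.1.1) (p.1.2 ⊔ p.2.2)]
      change (A p).direction = ⊤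
      rw [htop, AffineSubspace.direction_top]
    have h1 := Submodule.finrank_add_le_finrank_add_finrank p.1.2 p.2.2
    rw [hdir, finrank_top] at h1
    have h2 := hdim _ hp.1
    have h3 := hdim' _ hp.2
    omega
  obtain ⟨c, hc, hcA⟩ : (Metric.ball (0 : E) ε \ ⋃ p ∈ s ×ˢ s', (A p : Set E)).Nonempty := by
    refine MeasureTheory.nonempty_of_measure_ne_zero (μ := μ) ?_
    rw [MeasureTheory.measure_sdiff_null hnull]
    exact (Metric.measure_ball_pos μ 0 hε).ne'
  refine ⟨c, by simpa using hc, fun x hx y hy hxy => hcA ?_⟩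
  obtain ⟨q, hq, hxq⟩ := hcov x hx
  obtain ⟨q', hq', hyq'⟩ := hcov' y hy
  refine Set.mem_biUnion (x := (q, q')) ⟨hq, hq'⟩ ?_
  change c ∈ AffineSubspace.mk' (q'.1 - q.1) (q.2 ⊔ q'.2)
  rw [AffineSubspace.mem_mk', vsub_eq_sub]
  have : c - (q'.1 - q.1) = -(x - q.1) + (y - q'.1) := by rw [← hxy]; abel
  rw [this]
  exact Submodule.add_mem_sup (neg_mem hxq) hyq'

end Flats

/-! ### Covering dimension and approximation by maps into flats. -/

namespace TopDim

theorem exists_refinement_of_dim_le {Y : Type*} [TopologicalSpace Y] {a : ℕ}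
    (ha : dim Y ≤ a) {α : Set (Set Y)} (hα : IsFiniteOpenCover α) :
    ∃ β : Set (Set Y), IsFiniteOpenCover β ∧ Refines β α ∧
      ∀ y, {U ∈ β | y ∈ U}.encard ≤ a + 1 := by
  have h : minOrder α < a + 1 :=
    ((le_iSup₂ (f := fun (α : Set (Set Y)) (_ : IsFiniteOpenCover α) => minOrder α) α hα).trans
      ha).trans_lt (ENat.lt_add_one_iff (ENat.natCast_ne_top a) |>.2 le_rfl)
  simp only [minOrder, iInf_lt_iff] at h
  obtain ⟨β, ⟨hβ, hr⟩, hlt⟩ := h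
  refine ⟨β, hβ, hr, fun y => ?_⟩
  have h1 : order β ≤ a := ENat.lt_add_one_iff (ENat.natCast_ne_top a) |>.1 hlt
  exact tsub_le_iff_right.1 ((le_iSup (orderAt β) y).trans h1)

/-- On a compact Hausdorff space of covering dimension at most `a`, every continuous map to a normed
space can be approximated by continuous maps with image in a finite union of `a`-dimensional
affine subspaces. -/
theorem exists_approx_coveredByFlats {Y E : Type*} [TopologicalSpace Y] [CompactSpace Y] [T2Space Y]
    [NormedAddCommGroup E] [NormedSpace ℝ E] {a : ℕ} (ha : dim Y ≤ a) (F : C(Y, E))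
    {ε : ℝ} (hε : 0 < ε) :
    ∃ G : C(Y, E), (∀ y, ‖G y - F y‖ ≤ ε) ∧ CoveredByFlats a (Set.range G) := by
  classical
  obtain ⟨t, -, ht⟩ := isCompact_univ.elim_nhds_subcover (fun y => F ⁻¹' Metric.ball (F y) ε)
    fun y _ => F.continuous.continuousAt.preimage_mem_nhds (Metric.ball_mem_nhds _ hε)
  have hα : IsFiniteOpenCover ((fun y => F ⁻¹' Metric.ball (F y) ε) '' (t : Set Y)) := by
    refine ⟨t.finite_toSet.image _, ?_, ?_⟩
    · rintro _ ⟨y, -, rfl⟩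
      exact Metric.isOpen_ball.preimage F.continuous
    · rw [Set.sUnion_image]
      exact Set.univ_subset_iff.1 ht
  obtain ⟨β, ⟨hβf, hβo, hβc⟩, hβr, hβa⟩ := exists_refinement_of_dim_le ha hα
  have := hβf.to_subtype
  have := Fintype.ofFinite β
  have hcen : ∀ U : β, ∃ e : E, ∀ y ∈ U.1, ‖e - F y‖ ≤ ε := fun U => by
    obtain ⟨_, ⟨z, -, rfl⟩, hz⟩ := hβr U.1 U.2
    refine ⟨F z, fun y hy => ?_⟩
    rw [← dist_eq_norm, dist_comm]
    exact (Metric.mem_ball.1 (hz hy)).le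
  choose e he using hcen
  obtain ⟨φ, hφ⟩ := PartitionOfUnity.exists_isSubordinate isClosed_univ (fun U : β => U.1)
    (fun U => hβo U.1 U.2) (by rw [← Set.sUnion_eq_iUnion, hβc])
  have hsum : ∀ y, ∑ U, φ U y = 1 := fun y => by
    rw [← finsum_eq_sum_of_fintype, φ.sum_eq_one (Set.mem_univ y)]
  have hmem : ∀ (U : β) y, φ U y ≠ 0 → y ∈ U.1 := fun U y h =>
    hφ U (subset_tsupport _ h)
  have hsub : ∀ y v, ∑ U, φ U y • e U - v = ∑ U, φ U y • (e U - v) := fun y v => by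
    simp_rw [smul_sub, Finset.sum_sub_distrib, ← Finset.sum_smul, hsum, one_smul]
  refine ⟨⟨fun y => ∑ U, φ U y • e U, by fun_prop⟩, fun y => ?_, ?_⟩
  · change ‖∑ U, φ U y • e U - F y‖ ≤ ε
    rw [hsub]
    calc ‖∑ U, φ U y • (e U - F y)‖ ≤ ∑ U, φ U y * ε := by
          refine norm_sum_le_of_le _ fun U _ => ?_
          rw [norm_smul, Real.norm_of_nonneg (φ.nonneg U y)]
          by_cases h : φ U y = 0
          · simp [h]
          · exact mul_le_mul_of_nonneg_left (he U y (hmem U y h)) (φ.nonneg U y)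
      _ = ε := by rw [← Finset.sum_mul, hsum, one_mul]
  -- `G y` is a convex combination of the `e U` with `y ∈ U`, at most `a + 1` points, so it lies in
  -- their affine span.
  · let Q : β × Finset β → E × Submodule ℝ E :=
      fun p => (e p.1, vectorSpan ℝ (p.2.image e : Set E))
    refine ⟨Q '' {p | p.1 ∈ p.2 ∧ p.2.card ≤ a + 1}, Set.toFinite _, ?_, ?_⟩
    · rintro _ ⟨⟨U, r⟩, ⟨hU, hr⟩, rfl⟩
      have hpos : 0 < r.card := Finset.card_pos.2 ⟨U, hU⟩
      have hdim := finrank_vectorSpan_image_finset_le ℝ e r (n := r.card - 1) (by omega)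
      change finrank ℝ (vectorSpan ℝ (r.image e : Set E)) ≤ a
      simp only at hr
      omega
    · rintro _ ⟨y, rfl⟩
      obtain ⟨U, hU⟩ : ∃ U, φ U y ≠ 0 := by
        by_contra! h
        simpa [h] using hsum y
      refine ⟨_, ⟨(U, Finset.univ.filter fun V : β => y ∈ V.1), ⟨?_, ?_⟩, rfl⟩, ?_⟩
      · simpa using hmem U y hU
      · have hcard : ((Finset.univ.filter fun V : β => y ∈ V.1).card : ℕ∞) ≤ a + 1 := by
          rw [← Set.encard_coe_eq_coe_finsetCard,
            ← Subtype.val_injective.injOn.encard_image]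
          refine (Set.encard_le_encard ?_).trans (hβa y)
          rintro _ ⟨V, hV, rfl⟩
          exact ⟨V.2, by simpa using hV⟩
        exact_mod_cast hcard
      · change ∑ V, φ V y • e V - e U ∈ vectorSpan ℝ _
        rw [hsub]
        refine Submodule.sum_mem _ fun V _ => ?_
        by_cases h : φ V y = 0
        · simp [h]
        · refine Submodule.smul_mem _ _ (vsub_mem_vectorSpan ℝ ?_ ?_)
          · exact Finset.mem_coe.2 (Finset.mem_image_of_mem e (by simpa using hmem V y h))
          · exact Finset.mem_coe.2 (Finset.mem_image_of_mem e (by simpa using hmem U y hU))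

end TopDim

/-! ### Perturbing maps into the cube. -/

section Perturbation

variable {X Z : Type*} [TopologicalSpace X] [CompactSpace X] [T2Space X] [TopologicalSpace Z]
  [CompactSpace Z]

/-- To show that a set of maps `X → [0,1]^d` is dense it suffices to prescribe small perturbations
along an injectively mapped compact space. -/
theorem dense_of_exists_perturbation {d : ℕ} (e : C(Z, X)) (he : Function.Injective e)
    {D : Set C(X, Fin d → I)}
    (H : ∀ (f : C(X, Fin d → I)) (δ : ℝ), 0 < δ → ∃ h : C(Z, Fin d → ℝ),
      (∀ z l, |h z l - f (e z) l| ≤ δ) ∧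
        ∀ g : C(X, Fin d → I), (∀ z l, (g (e z) l : ℝ) = h z l) → g ∈ D) :
    Dense D := by
  refine Metric.dense_iff.2 fun f r hr => ?_
  obtain ⟨δ, hδ, hδr, hδ1⟩ : ∃ δ : ℝ, 0 < δ ∧ 2 * δ < r ∧ 2 * δ ≤ 1 :=
    ⟨min (r / 4) (1 / 2), by positivity, by linarith [min_le_left (r / 4) (1 / 2)],
      by linarith [min_le_right (r / 4) (1 / 2 : ℝ)]⟩
  have hlow : ∀ x l, 0 ≤ (1 - 2 * δ) * (f x l : ℝ) := fun x l =>
    mul_nonneg (by linarith) (f x l).2.1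
  have hhigh : ∀ x l, (1 - 2 * δ) * (f x l : ℝ) ≤ 1 - 2 * δ := fun x l =>
    mul_le_of_le_one_right (by linarith) (f x l).2.2
  -- Squeezing `f` into `[δ, 1 - δ]` leaves room for a Tietze-extended correction of size at most
  -- `δ`.
  let f₁ : C(X, Fin d → I) :=
    ⟨fun x l => ⟨(1 - 2 * δ) * (f x l : ℝ) + δ, by linarith [hlow x l], by linarith [hhigh x l]⟩,
      continuous_pi fun l => Continuous.subtype_mk (by fun_prop) _⟩
  have hf₁ : ∀ x l, (f₁ x l : ℝ) = (1 - 2 * δ) * (f x l : ℝ) + δ := fun _ _ => rfl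
  obtain ⟨h, hh, hD⟩ := H f₁ δ hδ
  have hext : ∀ l, ∃ k : C(X, ℝ), (∀ x, k x ∈ Set.Icc (-δ) δ) ∧
      ∀ z, k (e z) = h z l - f₁ (e z) l := fun l => by
    obtain ⟨k, hk, hke⟩ := ContinuousMap.exists_extension_forall_mem_of_isClosedEmbedding
      (⟨fun z => h z l - f₁ (e z) l, by fun_prop⟩ : C(Z, ℝ)) (t := Set.Icc (-δ) δ)
      (fun z => abs_le.1 (hh z l)) ⟨0, by constructor <;> linarith⟩
      (e.continuous.isClosedEmbedding he)
    exact ⟨k, hk, fun z => congrFun hke z⟩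
  choose k hk hke using hext
  let g : C(X, Fin d → I) :=
    ⟨fun x l => ⟨(f₁ x l : ℝ) + k l x,
        by linarith [hlow x l, hf₁ x l, (hk l x).1], by linarith [hhigh x l, hf₁ x l, (hk l x).2]⟩,
      continuous_pi fun l => Continuous.subtype_mk (by fun_prop) _⟩
  have hg : ∀ x l, (g x l : ℝ) = f₁ x l + k l x := fun _ _ => rfl
  refine ⟨g, ?_, hD g fun z l => by rw [hg, hke]; ring⟩
  rw [Metric.mem_ball]
  refine lt_of_le_of_lt ((ContinuousMap.dist_le (by linarith)).2 fun x => ?_) hδr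
  refine (dist_pi_le_iff (by linarith)).2 fun l => ?_
  rw [Subtype.dist_eq, Real.dist_eq, hg, hf₁, abs_le]
  have h0 := (f x l).2.1
  have h1 := (f x l).2.2
  have h2 := hk l x
  have h3 : 0 ≤ δ * (f x l : ℝ) := mul_nonneg hδ.le h0
  have h4 : δ * (f x l : ℝ) ≤ δ := mul_le_of_le_one_right hδ.le h1
  constructor <;> linarith [h2.1, h2.2]

end Perturbation

namespace DynSys

/-! ### Vectors invariant under a cyclic shift. -/

section CyclicInvariant

theorem finrank_fin_fun_fin_fun (n d : ℕ) : finrank ℝ (Fin n → Fin d → ℝ) = n * d := by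
  rw [finrank_pi_fintype]
  simp

variable (d : ℕ) {n : ℕ}

/-- The vectors in `(ℝ^d)^n` that are invariant under the cyclic shift by `j` coordinates. -/
def cyclicInvariant (hn : 0 < n) (j : ℕ) : Submodule ℝ (Fin n → Fin d → ℝ) where
  carrier := {w | ∀ i : Fin n, w ⟨(i + j) % n, Nat.mod_lt _ hn⟩ = w i}
  add_mem' hv hw i := by simp [hv i, hw i]
  zero_mem' i := rfl
  smul_mem' c w hw i := by simp [hw i]

/-- The `n`-periodic extension of an invariant vector also has period `j`, hence period `q = gcd j
n`. It is determined by `q` blocks, and `q` is a proper divisor of `n`. -/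
theorem two_mul_finrank_cyclicInvariant_le (hn : 0 < n) {j : ℕ} (hj : 0 < j) (hjn : j < n) :
    2 * finrank ℝ (cyclicInvariant d hn j) ≤ n * d := by
  set q := Nat.gcd j n with hq
  have hqpos : 0 < q := Nat.gcd_pos_of_pos_left _ hj
  have hqn : q < n := (Nat.gcd_le_left _ hj).trans_lt hjn
  have hdim : finrank ℝ (cyclicInvariant d hn j) ≤ finrank ℝ (Fin q → Fin d → ℝ) := by
    refine LinearMap.finrank_le_finrank_of_injective
      (f := (LinearMap.funLeft ℝ (Fin d → ℝ) (Fin.castLE hqn.le)).comp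
        (cyclicInvariant d hn j).subtype) ?_
    rw [injective_iff_map_eq_zero]
    rintro ⟨w, hw⟩ h0
    let u : ℕ → Fin d → ℝ := fun k => w ⟨k % n, Nat.mod_lt _ hn⟩
    have hmod : ∀ k l, k % n = l % n → u k = u l := fun k l h => by simp only [u, h]
    have huj : ∀ k, u (k + j) = u k := fun k => by
      have := hw ⟨k % n, Nat.mod_lt _ hn⟩
      simpa only [u, Nat.mod_add_mod] using this
    have hujm : ∀ m k, u (k + j * m) = u k := fun m => by
      induction m with
      | zero => simp
      | succ m ih => intro k; rw [Nat.mul_succ, ← add_assoc, huj, ih]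
    obtain ⟨m, -, hm⟩ := Nat.exists_mul_mod_eq_gcd (n := j) (k := n) hqn
    have hper : Function.Periodic u q := fun k => by
      rw [← hujm m k]
      refine hmod _ _ ?_
      rw [hq, ← hm, Nat.add_mod_mod]
    have hsmall : ∀ k < q, u k = 0 := fun k hk => by
      have : w ⟨k, hk.trans hqn⟩ = 0 := congrFun h0 ⟨k, hk⟩
      simpa only [u, Nat.mod_eq_of_lt (hk.trans hqn)] using this
    ext1
    funext i
    have : w i = u i := by simp only [u, Nat.mod_eq_of_lt i.2]
    change w i = 0
    rw [this, ← hper.map_mod_nat, hsmall _ (Nat.mod_lt _ hqpos)]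
  have hfin : finrank ℝ (Fin q → Fin d → ℝ) = q * d := finrank_fin_fun_fin_fun q d
  obtain ⟨c, hc⟩ : q ∣ n := Nat.gcd_dvd_right _ _
  have hc2 : 2 ≤ c := by
    rcases c with _ | _ | c
    · omega
    · simp only [zero_add, mul_one] at hc; omega
    · omega
  calc 2 * finrank ℝ (cyclicInvariant d hn j) ≤ 2 * (q * d) := by omega
    _ = q * 2 * d := by ring
    _ ≤ q * c * d := by gcongr
    _ = n * d := by rw [← hc]

end CyclicInvariant

/-! ### Separating maps and boxes of periodic points. -/

variable {X : Type*} [TopologicalSpace X] (T : X ≃ₜ X) {d : ℕ}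

theorem orbitMap_natCast (f : C(X, Fin d → I)) (x : X) (n : ℕ) :
    orbitMap T f x n = f (T^[n] x) := by
  have : ∀ n : ℕ, (T ^ n) x = T^[n] x := fun n => by
    induction n with
    | zero => rfl
    | succ n ih => rw [pow_succ', Homeomorph.mul_apply, ih, Function.iterate_succ_apply']
  rw [orbitMap, zpow_natCast, this]

theorem mem_separatingMaps_of_exists_nat {K : Set (X × X)} {f : C(X, Fin d → I)}
    (h : ∀ p ∈ K, ∃ n : ℕ, f (T^[n] p.1) ≠ f (T^[n] p.2)) : f ∈ separatingMaps T d K := by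
  intro p hp
  obtain ⟨n, hn⟩ := h p hp
  exact ⟨n, by rwa [orbitMap_natCast, orbitMap_natCast]⟩

theorem isOpen_separatingMaps [CompactSpace X] [T2Space X] {K : Set (X × X)} (hK : IsCompact K) :
    IsOpen (separatingMaps T d K) := by
  refine isOpen_iff_mem_nhds.2 fun f hf => ?_
  refine hK.eventually_forall_of_forall_eventually fun p hp => ?_
  obtain ⟨i, hi⟩ := hf p hp
  have h1 : Continuous fun z : C(X, Fin d → I) × (X × X) => orbitMap T z.1 z.2.1 i := by
    unfold orbitMap; fun_prop
  have h2 : Continuous fun z : C(X, Fin d → I) × (X × X) => orbitMap T z.1 z.2.2 i := by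
    unfold orbitMap; fun_prop
  filter_upwards [(isOpen_ne_fun h1 h2).mem_nhds (show (f, p) ∈ _ from hi)] with z hz
  exact ⟨i, hz⟩

theorem isClosed_periodicLE [T2Space X] (n : ℕ) : IsClosed (periodicLE T n) := by
  have : periodicLE T n = ⋃ k ∈ Set.Icc 1 n, {x | T^[k] x = x} := by
    ext x
    simp [periodicLE, Function.IsPeriodicPt, Function.IsFixedPt, and_assoc]
  rw [this]
  exact (Set.finite_Icc 1 n).isClosed_biUnion fun k _ =>
    isClosed_eq (T.continuous.iterate k) continuous_id

/-- The points of period at most `n` whose first `n` iterates lie in prescribed sets. -/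
def periodicBox {n : ℕ} (C : Fin n → Set X) : Set X :=
  {z | z ∈ periodicLE T n ∧ ∀ i : Fin n, T^[i] z ∈ C i}

theorem isClosed_periodicBox [T2Space X] {n : ℕ} {C : Fin n → Set X} (hC : ∀ i, IsClosed (C i)) :
    IsClosed (periodicBox T C) := by
  have : periodicBox T C = periodicLE T n ∩ ⋂ i : Fin n, T^[i] ⁻¹' C i := by
    ext; simp [periodicBox]
  rw [this]
  exact (isClosed_periodicLE T n).inter
    (isClosed_iInter fun i => (hC i).preimage (T.continuous.iterate i))

theorem periodicBox_mem_nhdsWithin {n : ℕ} {C : Fin n → Set X} {x : X}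
    (hC : ∀ i : Fin n, C i ∈ 𝓝 (T^[i] x)) : periodicBox T C ∈ 𝓝[periodicLE T n] x := by
  have : ∀ᶠ z in 𝓝 x, ∀ i : Fin n, T^[i] z ∈ C i :=
    Filter.eventually_all.2 fun i => (T.continuous.iterate i).continuousAt (hC i)
  filter_upwards [nhdsWithin_le_nhds this, self_mem_nhdsWithin] with z h1 h2
  exact ⟨h2, h1⟩

/-- A period `k < n` would put `z` in both `C 0` and `C k`. -/
theorem isPeriodicPt_of_mem_periodicBox {n : ℕ} {C : Fin n → Set X}
    (hC : Pairwise (Function.onFun Disjoint C)) {z : X} (hz : z ∈ periodicBox T C) :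
    Function.IsPeriodicPt T n z := by
  obtain ⟨⟨k, hk1, hkn, hk⟩, hzC⟩ := hz
  rcases hkn.eq_or_lt with rfl | hlt
  · exact hk
  · have h0 := hzC ⟨0, by omega⟩
    have h1 := hzC ⟨k, hlt⟩
    rw [show T^[((⟨k, hlt⟩ : Fin n) : ℕ)] z = z from hk] at h1
    refine absurd h1 (Set.disjoint_left.1 (hC ?_) h0)
    simp only [ne_eq, Fin.mk.injEq]
    omega

theorem exists_isClosed_nhds_pairwise_disjoint {ι : Type*} [Finite ι] [T2Space X] [RegularSpace X]
    {w : ι → X} (hw : Function.Injective w) :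
    ∃ C : ι → Set X, (∀ i, IsClosed (C i)) ∧ (∀ i, C i ∈ 𝓝 (w i)) ∧
      Pairwise (Function.onFun Disjoint C) := by
  obtain ⟨C, hC, hd⟩ := Pairwise.exists_mem_filter_basis_of_disjoint
    (l := fun i => 𝓝 (w i)) (fun i j hij => disjoint_nhds_nhds.2 (hw.ne hij))
    fun i => closed_nhds_basis (w i)
  exact ⟨C, fun i => (hC i).2, fun i => (hC i).1, hd⟩

/-- The values of `f` along the first `n` points of the orbit. -/
def orbitSegment (n : ℕ) (f : C(X, Fin d → I)) : C(periodicLE T n, Fin n → Fin d → ℝ) where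
  toFun y i l := f (T^[i] y) l
  continuous_toFun := by
    refine continuous_pi fun i => continuous_pi fun l => ?_
    have := T.continuous.iterate i
    fun_prop

theorem abs_sub_le_of_norm_sub_le {n : ℕ} {v w : Fin n → Fin d → ℝ} {δ : ℝ} (h : ‖v - w‖ ≤ δ)
    (i : Fin n) (l : Fin d) : |v i l - w i l| ≤ δ :=
  ((norm_le_pi_norm ((v - w) i) l).trans (norm_le_pi_norm (v - w) i)).trans h

/-! ### Density of the maps separating a compact piece. -/

theorem dense_separatingMaps_of_distinct_orbits [CompactSpace X] [T2Space X] {n m : ℕ} (hm : 0 < m)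
    {a b : ℕ} (ha : TopDim.dim (periodicLE T n) ≤ a) (hb : TopDim.dim (periodicLE T m) ≤ b)
    (hab : a + b < n * d) {C : Fin n ⊕ Fin m → Set X} (hCc : ∀ i, IsClosed (C i))
    (hCd : Pairwise (Function.onFun Disjoint C)) :
    Dense (separatingMaps T d
      (periodicBox T (fun i => C (.inl i)) ×ˢ periodicBox T fun i => C (.inr i))) := by
  set A := periodicBox T fun i => C (.inl i)
  set B := periodicBox T fun i => C (.inr i)
  have := isCompact_iff_compactSpace.1 (isClosed_periodicBox T fun i => hCc (.inl i)).isCompact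
  have := isCompact_iff_compactSpace.1 (isClosed_periodicBox T fun i => hCc (.inr i)).isCompact
  have := isCompact_iff_compactSpace.1 (isClosed_periodicLE T n).isCompact
  have := isCompact_iff_compactSpace.1 (isClosed_periodicLE T m).isCompact
  let e : C((Fin n × A) ⊕ (Fin m × B), X) :=
    ⟨Sum.elim (fun p => T^[p.1] p.2) (fun p => T^[p.1] p.2), by
      refine Continuous.sumElim ?_ ?_ <;> refine continuous_prod_of_discrete_left.2 fun i => ?_
      all_goals exact (T.continuous.iterate i).comp continuous_subtype_val⟩
  have hinj : Function.Injective e := by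
    have hmem : ∀ z, e z ∈ C (Sum.map Prod.fst Prod.fst z) := by
      rintro (⟨i, z⟩ | ⟨i, z⟩)
      · exact z.2.2 i
      · exact z.2.2 i
    intro z z' hzz
    have hidx : Sum.map Prod.fst Prod.fst z = Sum.map Prod.fst Prod.fst z' := by
      by_contra hne
      exact Set.disjoint_left.1 (hCd hne) (hmem z) (hzz ▸ hmem z')
    rcases z with ⟨i, z⟩ | ⟨i, z⟩ <;> rcases z' with ⟨i', z'⟩ | ⟨i', z'⟩ <;>
      simp only [Sum.map_inl, Sum.map_inr, Sum.inl.injEq, Sum.inr.injEq, reduceCtorEq] at hidx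
    all_goals
      subst hidx
      have : z = z' := Subtype.ext (T.injective.iterate _ hzz)
      rw [this]
  refine dense_of_exists_perturbation e hinj fun f δ hδ => ?_
  -- The approximation is made on all of `P_n`, where the dimension bound applies. The other `δ / 2`
  -- is kept for the translation `c`.
  obtain ⟨G, hG, hGa⟩ := TopDim.exists_approx_coveredByFlats ha (orbitSegment T n f) (half_pos hδ)
  obtain ⟨G', hG', hGb⟩ := TopDim.exists_approx_coveredByFlats hb (orbitSegment T m f) hδ
  -- `L` repeats an `m`-block periodically up to length `n`, as the orbit of `y` does; being linear,
  -- it keeps the flats at dimension at most `b`.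
  let L : (Fin m → Fin d → ℝ) →ₗ[ℝ] (Fin n → Fin d → ℝ) :=
    LinearMap.funLeft ℝ (Fin d → ℝ) fun i : Fin n => (⟨i % m, Nat.mod_lt _ hm⟩ : Fin m)
  obtain ⟨c, hc, hdisj⟩ := hGa.exists_translation (hGb.image L) (by rwa [finrank_fin_fun_fin_fun])
    (half_pos hδ)
  refine ⟨⟨Sum.elim (fun p => G ⟨p.2, p.2.2.1⟩ p.1 + c p.1) (fun p => G' ⟨p.2, p.2.2.1⟩ p.1), ?_⟩,
    ?_, fun g hg => ?_⟩
  · refine Continuous.sumElim ?_ ?_ <;> refine continuous_prod_of_discrete_left.2 fun i => ?_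
    all_goals dsimp only; fun_prop
  · rintro (⟨i, z⟩ | ⟨i, z⟩) l
    · have h1 := abs_sub_le_of_norm_sub_le (hG ⟨z, z.2.1⟩) i l
      have h2 := abs_sub_le_of_norm_sub_le (v := c) (w := 0) (by simpa using hc.le) i l
      change |G ⟨z, z.2.1⟩ i l + c i l - f (T^[i] z) l| ≤ δ
      change |G ⟨z, z.2.1⟩ i l - f (T^[i] z) l| ≤ δ / 2 at h1
      simp only [Pi.zero_apply, sub_zero] at h2
      rw [abs_le] at *
      constructor <;> linarith
    · exact abs_sub_le_of_norm_sub_le (hG' ⟨z, z.2.1⟩) i l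
  · refine mem_separatingMaps_of_exists_nat T ?_
    rintro ⟨x, y⟩ ⟨hx, hy⟩
    by_contra! heq
    refine hdisj _ ⟨⟨x, hx.1⟩, rfl⟩ _ ⟨_, ⟨⟨y, hy.1⟩, rfl⟩, rfl⟩ ?_
    funext i l
    have hper : Function.IsPeriodicPt T m y :=
      isPeriodicPt_of_mem_periodicBox T (hCd.comp_of_injective Sum.inr_injective) hy
    have h1 := hg (.inl (i, ⟨x, hx⟩)) l
    have h2 := hg (.inr (⟨i % m, Nat.mod_lt _ hm⟩, ⟨y, hy⟩)) l
    change (g (T^[i] x) l : ℝ) = (G ⟨x, hx.1⟩ + c) i l at h1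
    change (g (T^[i % m] y) l : ℝ) = L (G' ⟨y, hy.1⟩) i l at h2
    rw [hper.iterate_mod_apply] at h2
    rw [← h1, ← h2, heq i]

theorem dense_separatingMaps_of_same_orbit [CompactSpace X] [T2Space X] {n j : ℕ} (hj : 0 < j)
    (hjn : j < n) {a : ℕ} (ha : TopDim.dim (periodicLE T n) ≤ a) (had : 2 * a < n * d)
    {C : Fin n → Set X} (hCc : ∀ i, IsClosed (C i)) (hCd : Pairwise (Function.onFun Disjoint C)) :
    Dense (separatingMaps T d ((fun z => (z, T^[j] z)) '' periodicBox T C)) := by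
  have hn : 0 < n := hj.trans hjn
  set A := periodicBox T C
  have := isCompact_iff_compactSpace.1 (isClosed_periodicBox T hCc).isCompact
  have := isCompact_iff_compactSpace.1 (isClosed_periodicLE T n).isCompact
  let e : C(Fin n × A, X) := ⟨fun p => T^[p.1] p.2, continuous_prod_of_discrete_left.2 fun i =>
    (T.continuous.iterate i).comp continuous_subtype_val⟩
  have hinj : Function.Injective e := by
    rintro ⟨i, z⟩ ⟨i', z'⟩ hzz
    have hidx : i = i' := by
      by_contra hne
      exact Set.disjoint_left.1 (hCd hne) (z.2.2 i)
        (show T^[i] z ∈ C i' from (show T^[i] z = T^[i'] z' from hzz) ▸ z'.2.2 i')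
    subst hidx
    rw [show z = z' from Subtype.ext (T.injective.iterate _ hzz)]
  refine dense_of_exists_perturbation e hinj fun f δ hδ => ?_
  obtain ⟨G, hG, hGa⟩ := TopDim.exists_approx_coveredByFlats ha (orbitSegment T n f) (half_pos hδ)
  have hinv := two_mul_finrank_cyclicInvariant_le d hn hj hjn
  obtain ⟨c, hc, hdisj⟩ := hGa.exists_translation
    (coveredByFlats_submodule (cyclicInvariant d hn j))
    (by rw [finrank_fin_fun_fin_fun]; omega) (half_pos hδ)
  refine ⟨⟨fun p => G ⟨p.2, p.2.2.1⟩ p.1 + c p.1, ?_⟩, ?_, fun g hg => ?_⟩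
  · refine continuous_prod_of_discrete_left.2 fun i => ?_
    dsimp only; fun_prop
  · rintro ⟨i, z⟩ l
    have h1 := abs_sub_le_of_norm_sub_le (hG ⟨z, z.2.1⟩) i l
    have h2 := abs_sub_le_of_norm_sub_le (v := c) (w := 0) (by simpa using hc.le) i l
    change |G ⟨z, z.2.1⟩ i l + c i l - f (T^[i] z) l| ≤ δ
    change |G ⟨z, z.2.1⟩ i l - f (T^[i] z) l| ≤ δ / 2 at h1
    simp only [Pi.zero_apply, sub_zero] at h2
    rw [abs_le] at *
    constructor <;> linarith
  · refine mem_separatingMaps_of_exists_nat T ?_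
    rintro _ ⟨x, hx, rfl⟩
    by_contra! heq
    -- Unseparated orbits would make `G x + c` itself invariant under the shift by `j`.
    refine hdisj _ ⟨⟨x, hx.1⟩, rfl⟩ _ ?_ rfl
    intro i
    funext l
    have hper : Function.IsPeriodicPt T n x := isPeriodicPt_of_mem_periodicBox T hCd hx
    have h1 := hg (i, ⟨x, hx⟩) l
    have h2 := hg (⟨(i + j) % n, Nat.mod_lt _ hn⟩, ⟨x, hx⟩) l
    change (g (T^[i] x) l : ℝ) = (G ⟨x, hx.1⟩ + c) i l at h1
    change (g (T^[(i + j) % n] x) l : ℝ) = (G ⟨x, hx.1⟩ + c) _ l at h2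
    rw [hper.iterate_mod_apply, Function.iterate_add_apply] at h2
    rw [← h1, ← h2, heq i]

/-! ### Residual sets for each class of pairs. -/

theorem separatingMaps_mem_residual [CompactSpace X] [T2Space X] [SecondCountableTopology X]
    {S : Set (X × X)}
    (hS : ∀ p ∈ S, ∃ K ∈ 𝓝[S] p, IsCompact K ∧ Dense (separatingMaps T d K)) :
    separatingMaps T d S ∈ residual C(X, Fin d → I) := by
  choose! K hKn hKc hKd using hS
  obtain ⟨t, htS, htc, hcov⟩ := TopologicalSpace.countable_cover_nhdsWithin hKn
  refine Filter.mem_of_superset ((countable_bInter_mem htc).2 fun p hp =>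
    residual_of_dense_open (isOpen_separatingMaps T (hKc p (htS hp))) (hKd p (htS hp))) ?_
  intro f hf q hq
  obtain ⟨p, hp, hqp⟩ := Set.mem_iUnion₂.1 (hcov hq)
  exact Set.mem_iInter₂.1 hf p hp q hqp

theorem exists_dim_periodicLE_le (hT : perdim T < (d : ℝ≥0∞) / 2) {n : ℕ} (hn : 0 < n) :
    ∃ a : ℕ, TopDim.dim (periodicLE T n) ≤ a ∧ 2 * a < n * d := by
  have h : ((TopDim.dim (periodicLE T n) : ℕ∞) : ℝ≥0∞) / (n : ℝ≥0∞) < (d : ℝ≥0∞) / 2 :=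
    (le_iSup₂ (f := fun (k : ℕ) (_ : 1 ≤ k) =>
      ((TopDim.dim (periodicLE T k) : ℕ∞) : ℝ≥0∞) / (k : ℝ≥0∞)) n hn).trans_lt hT
  have hn0 : (n : ℝ≥0∞) ≠ 0 := by exact_mod_cast hn.ne'
  rw [ENNReal.div_lt_iff (.inl hn0) (.inl (ENNReal.natCast_ne_top n))] at h
  cases hdim : TopDim.dim (periodicLE T n) with
  | top =>
    rw [hdim] at h
    simp at h
  | coe a =>
    refine ⟨a, le_rfl, ?_⟩
    rw [hdim] at h
    have h2 : (2 : ℝ≥0∞) * (a : ℝ≥0∞) < 2 * ((d : ℝ≥0∞) / 2 * n) :=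
      (ENNReal.mul_lt_mul_iff_right two_ne_zero ENNReal.ofNat_ne_top).2 (by simpa using h)
    rw [← mul_assoc, ENNReal.mul_div_cancel two_ne_zero ENNReal.ofNat_ne_top] at h2
    have h3 : 2 * a < d * n := by exact_mod_cast h2
    rwa [mul_comm n d]

variable [CompactSpace X] [T2Space X] [SecondCountableTopology X]

theorem separatingMaps_distinct_orbits_mem_residual (hT : perdim T < (d : ℝ≥0∞) / 2) {n m : ℕ}
    (hm : 0 < m) (hmn : m ≤ n) :
    separatingMaps T d {p | Function.minimalPeriod T p.1 = n ∧ Function.minimalPeriod T p.2 = m ∧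
      ∀ i : ℕ, p.2 ≠ T^[i] p.1} ∈ residual C(X, Fin d → I) := by
  have hn : 0 < n := hm.trans_le hmn
  obtain ⟨a, ha, had⟩ := exists_dim_periodicLE_le T hT hn
  obtain ⟨b, hb, hbd⟩ := exists_dim_periodicLE_le T hT hm
  have hab : a + b < n * d := by
    have : m * d ≤ n * d := Nat.mul_le_mul_right d hmn
    omega
  have hle : ∀ {x : X} {k : ℕ}, 0 < k → Function.minimalPeriod T x = k → x ∈ periodicLE T k := by
    rintro x k hk rfl
    exact ⟨_, hk, le_rfl, Function.isPeriodicPt_minimalPeriod _ _⟩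
  refine separatingMaps_mem_residual T ?_
  rintro ⟨x, y⟩ ⟨hx, hy, hxy⟩
  dsimp only at hx hy hxy
  have hw : Function.Injective
      (Sum.elim (fun i : Fin n => T^[i] x) fun i : Fin m => T^[i] y) := by
    refine Function.Injective.sumElim ?_ ?_ ?_
    · intro i k hik
      exact Fin.ext (Function.iterate_injOn_Iio_minimalPeriod (hx ▸ i.2) (hx ▸ k.2) hik)
    · intro i k hik
      exact Fin.ext (Function.iterate_injOn_Iio_minimalPeriod (hy ▸ i.2) (hy ▸ k.2) hik)
    · intro i k hik
      -- Applying `T^[m - k]` to `T^[i] x = T^[k] y` yields `y`, since `T^[m] y = y`.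
      refine hxy (m - k + i) ?_
      rw [Function.iterate_add_apply, hik, ← Function.iterate_add_apply,
        Nat.sub_add_cancel k.2.le, ← hy]
      exact (Function.isPeriodicPt_minimalPeriod T y).symm
  obtain ⟨C, hCc, hCn, hCd⟩ := exists_isClosed_nhds_pairwise_disjoint hw
  refine ⟨_, ?_, ((isClosed_periodicBox T fun i => hCc (.inl i)).prod
    (isClosed_periodicBox T fun i => hCc (.inr i))).isCompact,
    dense_separatingMaps_of_distinct_orbits T hm ha hb hab hCc hCd⟩
  refine nhdsWithin_mono (t := periodicLE T n ×ˢ periodicLE T m) _ ?_ ?_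
  · rintro ⟨x', y'⟩ ⟨hx', hy', -⟩
    exact ⟨hle hn hx', hle hm hy'⟩
  · rw [nhdsWithin_prod_eq]
    exact Filter.prod_mem_prod (periodicBox_mem_nhdsWithin T fun i => hCn (.inl i))
      (periodicBox_mem_nhdsWithin T fun i => hCn (.inr i))

theorem separatingMaps_same_orbit_mem_residual (hT : perdim T < (d : ℝ≥0∞) / 2) {n j : ℕ}
    (hj : 0 < j) (hjn : j < n) :
    separatingMaps T d {p | Function.minimalPeriod T p.1 = n ∧ p.2 = T^[j] p.1} ∈
      residual C(X, Fin d → I) := by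
  have hn : 0 < n := hj.trans hjn
  obtain ⟨a, ha, had⟩ := exists_dim_periodicLE_le T hT hn
  refine separatingMaps_mem_residual T ?_
  rintro ⟨x, y⟩ ⟨hx, hy⟩
  dsimp only at hx hy
  have hw : Function.Injective fun i : Fin n => T^[i] x := fun i k hik =>
    Fin.ext (Function.iterate_injOn_Iio_minimalPeriod (hx ▸ i.2) (hx ▸ k.2) hik)
  obtain ⟨C, hCc, hCn, hCd⟩ := exists_isClosed_nhds_pairwise_disjoint hw
  have hgraph : Continuous fun z : X => (z, T^[j] z) :=
    continuous_id.prodMk (T.continuous.iterate j)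
  refine ⟨_, ?_, (isClosed_periodicBox T hCc).isCompact.image hgraph,
    dense_separatingMaps_of_same_orbit T hj hjn ha had hCc hCd⟩
  -- The class is a graph over its first coordinate, so neighbourhoods of `x` within `P_n` pull back
  -- to it.
  have htend : Filter.Tendsto Prod.fst
      (𝓝[{p : X × X | Function.minimalPeriod T p.1 = n ∧ p.2 = T^[j] p.1}] (x, y))
      (𝓝[periodicLE T n] x) := by
    refine continuous_fst.continuousAt.continuousWithinAt.tendsto_nhdsWithin ?_
    rintro p ⟨hp, -⟩
    exact ⟨n, hn, le_rfl, hp ▸ Function.isPeriodicPt_minimalPeriod T p.1⟩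
  filter_upwards [htend (periodicBox_mem_nhdsWithin T hCn), self_mem_nhdsWithin]
  rintro ⟨x', y'⟩ h1 ⟨-, h2⟩
  exact ⟨x', h1, Prod.ext rfl h2.symm⟩

end DynSys

/-! ### Intersecting the countably many classes. -/

theorem mainTheorem6 {X : Type*} [TopologicalSpace X] [CompactSpace X]
    [TopologicalSpace.MetrizableSpace X] (T : X ≃ₜ X) (d : ℕ)
    (hT : DynSys.perdim T < (d : ℝ≥0∞) / 2) :
    Dense (DynSys.separatingMaps T d
      ((Function.periodicPts T ×ˢ Function.periodicPts T) \ Set.diagonal X)) := by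
  have hdist := eventually_countable_forall.2 fun n : ℕ => eventually_countable_forall.2
    fun m : ℕ => eventually_countable_forall.2 fun hm : 0 < m => eventually_countable_forall.2
    fun hmn : m ≤ n => DynSys.separatingMaps_distinct_orbits_mem_residual T hT hm hmn
  have hsame := eventually_countable_forall.2 fun n : ℕ => eventually_countable_forall.2
    fun j : ℕ => eventually_countable_forall.2 fun hj : 0 < j => eventually_countable_forall.2
    fun hjn : j < n => DynSys.separatingMaps_same_orbit_mem_residual T hT hj hjn
  refine dense_of_mem_residual ?_
  filter_upwards [hdist, hsame] with f hf hf'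
  rintro ⟨x, y⟩ ⟨⟨hx, hy⟩, hne⟩
  have hpx := Function.minimalPeriod_pos_of_mem_periodicPts hx
  have hpy := Function.minimalPeriod_pos_of_mem_periodicPts hy
  by_cases hxy : ∃ i : ℕ, y = T^[i] x
  · obtain ⟨i, rfl⟩ := hxy
    dsimp only at hpx hne ⊢
    rw [← Function.iterate_mod_minimalPeriod_eq] at hne ⊢
    refine hf' _ (i % Function.minimalPeriod T x) (Nat.pos_of_ne_zero fun h0 => hne ?_)
      (Nat.mod_lt _ hpx) (x, _) ⟨rfl, rfl⟩
    rw [h0]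
    rfl
  · push Not at hxy
    rcases le_total (Function.minimalPeriod T y) (Function.minimalPeriod T x) with h | h
    · exact hf _ _ hpy h (x, y) ⟨rfl, rfl, hxy⟩
    · have hyx : ∀ i : ℕ, x ≠ T^[i] y := fun i hi => by
        -- With `p` the period of `y`, `T^[p * i - i]` sends `x = T^[i] y` to `T^[p * i] y = y`.
        -- Thus the pair can be swapped to put the larger period first.
        refine hxy (Function.minimalPeriod T y * i - i) ?_
        rw [hi, ← Function.iterate_add_apply, Nat.sub_add_cancel (Nat.le_mul_of_pos_left i hpy)]
        exact ((Function.isPeriodicPt_minimalPeriod T y).mul_const i).symm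
      obtain ⟨i, hi⟩ := hf _ _ hpx h (y, x) ⟨rfl, rfl, hyx⟩
      exact ⟨i, hi.symm⟩
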